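/- Let $\mathcal H$ be a complex Hilbert space with inner product $\langle\cdot,\cdot\rangle$, conjugate linear in the first variable, and let $\mathcal D\subset\mathcal H$ be a dense linear subspace with $\dim\mathcal D\neq 1$. Let $\mathcal L^+(\mathcal D)$ be the $*$-algebra of all linear operators $A$ on $\mathcal D$ with $A\mathcal D\subset\mathcal D$ and $A^*\mathcal D\subset\mathcal D$, with the involution $A^+=A^*|_{\mathcal D}$. Assume that $\mathcal D$ is an (F)-domain, i.e. that $\mathcal D$ is metrizable and complete in the topology generated by the seminorms $\phi\mapsto\|A\phi\|$, $A\in\mathcal L^+(\mathcal D)$. Let $\mathcal A\subset\mathcal L^+(\mathcal D)$ be a unital standard $*$-operator algebra, i.e. a $*$-subalgebra that contains the identity $I$ and all finite rank operators of $\mathcal L^+(\mathcal D)$. Let $\Phi:\mathcal A\to\mathcal A$ be an additive bijection such that for all $A,B\in\mathcal A$ 1. $A^+B=0$ if and only if $\Phi(A)^+\Phi(B)=0$, and 2. $AB^+=0$ if and only if $\Phi(A)\Phi(B)^+=0$. Then there are a nonzero constant $c\in\mathbb C$ and operators $U,V:\mathcal D\to\mathcal D$, both unitary or both antiunitary, such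 that $$\Phi(T)=c\,UTV\qquad(T\in\mathcal A).$$ If in addition $\Phi(I)=I$, then there is a unitary or antiunitary operator $U:\mathcal D\to\mathcal D$ such that $$\Phi(T)=UTU^+\qquad(T\in\mathcal A).$$ Here $U:\mathcal D\to\mathcal D$ is called unitary if it is linear and onto with $\langle Ux,Uy\rangle=\langle x,y\rangle$ for all $x,y\in\mathcal D$, and antiunitary if it is conjugate linear and onto with $\langle Ux,Uy\rangle=\langle y,x\rangle$ for all $x,y\in\mathcal D$; $U^+$ is the operator on $\mathcal D$ with $\langle U^+x,y\rangle=\langle x,Uy\rangle$ if $U$ is unitary, and $\langle U^+x,y\rangle=\langle Uy,x\rangle$ if $U$ is antiunitary, for all $x,y\in\mathcal D$. -/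

import Mathlib

open scoped InnerProductSpace ComplexConjugate

namespace UnboundedOp

variable {H : Type*} [NormedAddCommGroup H] [InnerProductSpace ℂ H]

/-- The algebra `L⁺(D)` of all linear operators `A : D → D` with `A* D ⊆ D`. The vector `x ∈ D`
lies in the domain of `A*` with `A* x = z ∈ D` exactly when `⟪z, y⟫ = ⟪x, A y⟫` for all `y ∈ D`, so
the second condition says that `A` has a formal adjoint `B : D → D`.
(Mathlib's inner product is conjugate linear in the first variable.) -/
def LPlus (D : Submodule ℂ H) : Subalgebra ℂ (Module.End ℂ D) where
  carrier := {A | ∃ B : Module.End ℂ D, ∀ x y : D, ⟪B x, y⟫_ℂ = ⟪x, A y⟫_ℂ}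
  mul_mem' := by
    rintro A A' ⟨B, hB⟩ ⟨B', hB'⟩
    exact ⟨B' * B, fun x y => by simp only [Module.End.mul_apply, hB', hB]⟩
  add_mem' := by
    rintro A A' ⟨B, hB⟩ ⟨B', hB'⟩
    exact ⟨B + B', fun x y => by
      simp only [LinearMap.add_apply, inner_add_left, inner_add_right, hB', hB]⟩
  algebraMap_mem' := by
    intro r
    exact ⟨algebraMap ℂ _ (conj r), fun x y => by
      simp only [Module.algebraMap_end_apply, inner_smul_left, inner_smul_right,
        Complex.conj_conj]⟩

variable {D : Submodule ℂ H}

/-- The involution `A ↦ A⁺ = A*|_D` on `L⁺(D)`. -/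
noncomputable instance : Star (LPlus D) where
  star A := ⟨A.2.choose, A.1, fun x y => by
    rw [← inner_conj_symm, ← A.2.choose_spec y x, inner_conj_symm]⟩

/-- The defining property of `A⁺`. -/
theorem inner_star_left (A : LPlus D) (x y : D) :
    ⟪(star A).1 x, y⟫_ℂ = ⟪x, A.1 y⟫_ℂ :=
  A.2.choose_spec x y

/-- `A⁺` is the only formal adjoint of `A`. -/
theorem star_unique {A B : LPlus D} (h : ∀ x y : D, ⟪B.1 x, y⟫_ℂ = ⟪x, A.1 y⟫_ℂ) :
    star A = B := by
  apply Subtype.ext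
  apply LinearMap.ext
  intro x
  apply ext_inner_right ℂ
  intro y
  rw [inner_star_left, h]

noncomputable instance : StarRing (LPlus D) where
  star_involutive A := star_unique fun x y => by
    rw [← inner_conj_symm, ← inner_star_left A y x, inner_conj_symm]
  star_mul A B := star_unique fun x y => by
    simp only [Subalgebra.coe_mul, Module.End.mul_apply, inner_star_left]
  star_add A B := star_unique fun x y => by
    simp only [Subalgebra.coe_add, LinearMap.add_apply, inner_add_left, inner_add_right,
      inner_star_left]

instance : StarModule ℂ (LPlus D) where
  star_smul r A := star_unique fun x y => by
    simp only [Subalgebra.coe_smul, LinearMap.smul_apply, inner_smul_left, inner_smul_right,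
      inner_star_left, RCLike.star_def, Complex.conj_conj]

/-- The seminorm `x ↦ ‖A x‖` on `D`. -/
noncomputable def graphSeminorm (A : LPlus D) : Seminorm ℂ D :=
  (normSeminorm ℂ D).comp A.1

/-- The uniform structure on `D` generated by the seminorms `x ↦ ‖A x‖`, `A ∈ L⁺(D)`; its topology
is the graph topology `t` induced by `L⁺(D)`. -/
@[reducible] noncomputable def graphUniformSpace (D : Submodule ℂ H) : UniformSpace D :=
  ⨅ A : LPlus D,
    (graphSeminorm A).toSeminormedAddCommGroup.toPseudoMetricSpace.toUniformSpace

/-- `D` is an (F)-domain: it is dense in `H`, and with the graph topology it is an (F)-space, i.e.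
metrizable and complete. -/
structure IsFDomain (D : Submodule ℂ H) : Prop where
  dense : Dense (D : Set H)
  metrizable : @TopologicalSpace.MetrizableSpace D (graphUniformSpace D).toTopologicalSpace
  complete : @CompleteSpace D (graphUniformSpace D)

/-- `A` has finite rank. -/
def IsFiniteRank (A : LPlus D) : Prop :=
  FiniteDimensional ℂ (LinearMap.range A.1)

/-- A unital star subalgebra of `L⁺(D)` is standard if it contains all finite rank operators
of `L⁺(D)`. (A `StarSubalgebra` contains the identity.) -/
def IsStandard (𝒜 : StarSubalgebra ℂ (LPlus D)) : Prop :=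
  ∀ A : LPlus D, IsFiniteRank A → A ∈ 𝒜

/-- `U : D → D` is unitary: linear, onto, preserving the inner product. -/
structure IsUnitaryOn (U : D → D) : Prop where
  map_add : ∀ x y, U (x + y) = U x + U y
  map_smul : ∀ (r : ℂ) (x), U (r • x) = r • U x
  surjective : Function.Surjective U
  inner_map : ∀ x y, ⟪U x, U y⟫_ℂ = ⟪x, y⟫_ℂ

/-- `U : D → D` is antiunitary: conjugate linear, onto, conjugating the inner product. -/
structure IsAntiunitaryOn (U : D → D) : Prop where
  map_add : ∀ x y, U (x + y) = U x + U y
  map_smul : ∀ (r : ℂ) (x), U (r • x) = conj r • U x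
  surjective : Function.Surjective U
  inner_map : ∀ x y, ⟪U x, U y⟫_ℂ = ⟪y, x⟫_ℂ

/-- `W = U⁺` for a linear operator `U`. -/
def IsAdjointOn (U W : D → D) : Prop :=
  ∀ x y, ⟪W x, y⟫_ℂ = ⟪x, U y⟫_ℂ

/-- `W = U⁺` for a conjugate linear operator `U`. -/
def IsAntiAdjointOn (U W : D → D) : Prop :=
  ∀ x y, ⟪W x, y⟫_ℂ = ⟪U y, x⟫_ℂ

end UnboundedOp

open scoped InnerProductSpace ComplexConjugate

namespace UnboundedOp

variable {H : Type*} [NormedAddCommGroup H] [InnerProductSpace ℂ H] {D : Submodule ℂ H}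

/-! Write x⊗y for the operator z ↦ ⟪y, z⟫ x. Since A⁺B = 0 means that A and B have orthogonal
ranges, the relation `LeftLE` is intrinsic to the orthogonality structure and `Φ` respects it both
ways. The operators below x⊗y are exactly the x⊗z (`leftLE_rk_iff`), so `Φ` maps rank one operators
to rank one operators (`exists_map_rk`), and Φ(x⊗y) = Ux⊗Wy with additive U, W that preserve
orthogonality and map lines into lines.

In dimension at least two such a map is semilinear for a ring endomorphism of ℂ. Preservation of
orthogonality makes this endomorphism commute with conjugation, so it is the identity or conjugation
without any continuity assumption, and the map is a positive multiple of a unitary or antiunitary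
operator (`exists_unitary_or_antiunitary`).

A general T is compared at each vector x with a rank one R such that Rx = Tx. As T - R kills x, Φ(T
- R) kills Wx, whence Φ(T)Wx = Φ(R)Wx (`apply_eq_of_map_rk`). -/

/-! ### Additive maps preserving lines and orthogonality. -/

/-- If `f` and `g` are additive, `f x` is a multiple of `g x` for all `x`, and the range of `g` is
not contained in a line, then `f` is a multiple of `g`. -/
theorem exists_smul_of_forall_exists_smul {E F : Type*} [AddCommGroup E] [AddCommGroup F]
    [Module ℂ F] {f g : E → F} (hf : ∀ x y, f (x + y) = f x + f y)
    (hg : ∀ x y, g (x + y) = g x + g y) (hfg : ∀ x, ∃ k : ℂ, f x = k • g x)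
    (hrank : ∀ x, ∃ z, ∀ a b : ℂ, a • g x + b • g z = 0 → b = 0) :
    ∃ k : ℂ, ∀ x, f x = k • g x := by
  choose k hk using hfg
  have key : ∀ x z, g x ≠ 0 → (∀ a b : ℂ, a • g x + b • g z = 0 → b = 0) → k x = k z := by
    intro x z hx hz
    have h1 := hf x z
    rw [hk, hk x, hk z, hg] at h1
    have h2 : (k (x + z) - k x) • g x + (k (x + z) - k z) • g z = 0 := by
      have e1 : (k (x + z) - k x) • g x + (k (x + z) - k z) • g z =
        k (x + z) • (g x + g z) - (k x • g x + k z • g z) := by module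
      rw [e1, h1, sub_self]
    have h3 := hz _ _ h2
    rw [h3, zero_smul, add_zero, smul_eq_zero, or_iff_left hx] at h2
    rw [← sub_eq_zero.1 h2, sub_eq_zero.1 h3]
  by_cases h0 : ∀ x, g x = 0
  · exact ⟨0, fun x => by rw [hk, h0, smul_zero, smul_zero]⟩
  push Not at h0
  obtain ⟨x, hx⟩ := h0
  refine ⟨k x, fun y => ?_⟩
  by_cases hy : g y = 0
  · rw [hk, hy, smul_zero, smul_zero]
  rw [hk]
  congr 1
  obtain ⟨z, hz⟩ := hrank x
  -- If `g z` is off the line of `g y`, both factors equal `k z`. Otherwise `g z` lies on that line,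
  -- so `g y` cannot lie on the line of `g x`, and `x`, `y` are compared directly.
  by_cases hyz : ∀ a b : ℂ, a • g y + b • g z = 0 → b = 0
  · rw [key y z hy hyz, key x z hx hz]
  · push Not at hyz
    obtain ⟨a, b, hab, hb⟩ := hyz
    refine (key x y hx fun c d hcd => ?_).symm
    by_contra hd
    have h1 : (a * c) • g x + (-(d * b)) • g z = 0 := by
      have e1 : a • (c • g x + d • g y) - d • (a • g y + b • g z) = 0 := by
        rw [hcd, hab, smul_zero, smul_zero, sub_zero]
      rw [← e1]
      module
    exact mul_ne_zero hd hb (neg_eq_zero.1 (hz _ _ h1))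

/-- A ring endomorphism of `ℂ` that commutes with conjugation is the identity or conjugation. -/
theorem ringHom_eq_id_or_conj {τ : ℂ →+* ℂ} (h : ∀ z, τ (conj z) = conj (τ z)) :
    (∀ z, τ z = z) ∨ ∀ z, τ z = conj z := by
  -- Commuting with conjugation forces real values on ℝ, and the only ring endomorphism of ℝ is the
  -- identity.
  have hre : ∀ r : ℝ, ((τ r).re : ℂ) = τ r := fun r => by
    rw [← Complex.conj_eq_iff_re, ← h, Complex.conj_ofReal]
  let σ : ℝ →+* ℝ :=
    { toFun := fun r => (τ r).re
      map_one' := by simp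
      map_zero' := by simp
      map_add' := fun r s => by simp
      map_mul' := fun r s => by
        have h1 : (τ (r : ℂ)).im = 0 := by rw [← hre]; simp
        simp [h1] }
  have hσ : ∀ r : ℝ, τ r = r := fun r => by
    rw [← hre]
    exact congrArg Complex.ofReal
      (congrArg (fun f : ℝ →+* ℝ => f r) (Subsingleton.elim σ (RingHom.id ℝ)))
  let φ : ℂ →ₐ[ℝ] ℂ := { τ with commutes' := hσ }
  rcases Complex.real_algHom_eq_id_or_conj φ with h1 | h1
  · exact Or.inl fun z => congrArg (fun f : ℂ →ₐ[ℝ] ℂ => f z) h1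
  · exact Or.inr fun z => congrArg (fun f : ℂ →ₐ[ℝ] ℂ => f z) h1

/-- The component of `x` orthogonal to `y`. -/
theorem inner_sub_proj {E : Type*} [NormedAddCommGroup E] [InnerProductSpace ℂ E] (x y : E) :
    ⟪y, x - (⟪y, x⟫_ℂ / ⟪y, y⟫_ℂ) • y⟫_ℂ = 0 := by
  by_cases hy : y = 0
  · simp [hy]
  · rw [inner_sub_right, inner_smul_right, div_mul_cancel₀ _ (inner_self_ne_zero.2 hy), sub_self]

/-- If the dimension is not one, then no nonzero vector spans its orthogonal complement. -/
theorem exists_ne_zero_inner_eq_zero {E : Type*} [NormedAddCommGroup E] [InnerProductSpace ℂ E]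
    (hdim : Module.finrank ℂ E ≠ 1) {y : E} (hy : y ≠ 0) : ∃ z : E, z ≠ 0 ∧ ⟪y, z⟫_ℂ = 0 := by
  by_contra! h
  refine hdim (finrank_eq_one_iff'.2 ⟨y, hy, fun x => ⟨⟪y, x⟫_ℂ / ⟪y, y⟫_ℂ, ?_⟩⟩)
  by_contra hx
  exact h _ (sub_ne_zero.2 (Ne.symm hx)) (inner_sub_proj x y)

/-- A map that preserves orthogonality and nonzero vectors does not map `D` into a line. -/
theorem exists_independent_image (hdim : Module.finrank ℂ D ≠ 1) [Nontrivial D] {U : D → D}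
    (hne : ∀ x, x ≠ 0 → U x ≠ 0) (horth : ∀ x y, ⟪x, y⟫_ℂ = 0 → ⟪U x, U y⟫_ℂ = 0) (x : D) :
    ∃ z, ∀ a b : ℂ, a • U x + b • U z = 0 → b = 0 := by
  obtain ⟨z, hz, hxz⟩ : ∃ z : D, z ≠ 0 ∧ ⟪x, z⟫_ℂ = 0 := by
    by_cases hx : x = 0
    · obtain ⟨z, hz⟩ := exists_ne (0 : D)
      exact ⟨z, hz, by simp [hx]⟩
    · exact exists_ne_zero_inner_eq_zero hdim hx
  refine ⟨z, fun a b h => ?_⟩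
  have h1 := congrArg (fun w => ⟪U z, w⟫_ℂ) h
  simp only [inner_add_right, inner_smul_right, inner_zero_right,
    horth z x (inner_eq_zero_symm.1 hxz), mul_zero, zero_add] at h1
  exact (mul_eq_zero.1 h1).resolve_right (inner_self_ne_zero.2 (hne z hz))

/-- An additive map of `D` that maps lines into lines and preserves orthogonality is a positive
multiple of a unitary or antiunitary operator. -/
theorem exists_unitary_or_antiunitary (hdim : Module.finrank ℂ D ≠ 1) {U : D → D}
    (hadd : ∀ x y, U (x + y) = U x + U y) (hsurj : Function.Surjective U)
    (hne : ∀ x, x ≠ 0 → U x ≠ 0) (hline : ∀ (r : ℂ) (x), ∃ k : ℂ, U (r • x) = k • U x)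
    (horth : ∀ x y, ⟪x, y⟫_ℂ = 0 → ⟪U x, U y⟫_ℂ = 0) [Nontrivial D] :
    ∃ (a : ℝ) (V : D → D), 0 < a ∧ (∀ x, U x = (a : ℂ) • V x) ∧
      (IsUnitaryOn V ∨ IsAntiunitaryOn V) := by
  let Ua : D →+ D := AddMonoidHom.mk' U hadd
  have hU0 : U 0 = 0 := Ua.map_zero
  have hneg : ∀ x, U (-x) = -U x := Ua.map_neg
  have hrank := exists_independent_image hdim hne horth
  have hτ : ∀ r : ℂ, ∃ k : ℂ, ∀ x, U (r • x) = k • U x := fun r =>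
    exists_smul_of_forall_exists_smul (f := fun x => U (r • x))
      (fun x y => by rw [smul_add, hadd]) hadd (hline r) hrank
  choose t ht using hτ
  obtain ⟨e, he⟩ := exists_ne (0 : D)
  have hcancel : ∀ {a b : ℂ}, a • U e = b • U e → a = b := fun h =>
    smul_left_injective ℂ (hne e he) h
  let τ : ℂ →+* ℂ :=
    { toFun := t
      map_one' := hcancel (by rw [← ht, one_smul, one_smul])
      map_zero' := hcancel (by rw [← ht, zero_smul, zero_smul, hU0])
      map_add' := fun r s => hcancel (by rw [← ht, add_smul, hadd, ht, ht, add_smul])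
      map_mul' := fun r s => hcancel (by rw [← ht, mul_smul, ht, ht, mul_smul]) }
  have hsmul : ∀ (r : ℂ) (x), U (r • x) = τ r • U x := ht
  obtain ⟨f₀, hf₀, hef₀⟩ := exists_ne_zero_inner_eq_zero hdim he
  -- equal norms of orthogonal vectors are preserved
  have hnorm : ∀ x y : D, ⟪x, y⟫_ℂ = 0 → ⟪x, x⟫_ℂ = ⟪y, y⟫_ℂ → ⟪U x, U x⟫_ℂ = ⟪U y, U y⟫_ℂ := by
    intro x y hxy hn
    have h1 := horth (x + y) (x + -y) (by
      simp only [inner_add_left, inner_add_right, inner_neg_right, hxy,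
        inner_eq_zero_symm.1 hxy, hn]
      ring)
    simp only [hadd, hneg, inner_add_left, inner_add_right, inner_neg_right, horth x y hxy,
      horth y x (inner_eq_zero_symm.1 hxy)] at h1
    linear_combination h1
  have hself : ∀ x : D, ⟪x, x⟫_ℂ = ((‖x‖ ^ 2 : ℝ) : ℂ) := fun x => by
    rw [inner_self_eq_norm_sq_to_K]; norm_cast
  obtain ⟨f, hf, hef, hfe⟩ : ∃ f : D, f ≠ 0 ∧ ⟪e, f⟫_ℂ = 0 ∧ ⟪e, e⟫_ℂ = ⟪f, f⟫_ℂ := by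
    have hf₁ : ‖f₀‖ ≠ 0 := norm_ne_zero_iff.2 hf₀
    have he₁ : ‖e‖ ≠ 0 := norm_ne_zero_iff.2 he
    refine ⟨((‖e‖ / ‖f₀‖ : ℝ) : ℂ) • f₀, ?_, ?_, ?_⟩
    · exact smul_ne_zero (Complex.ofReal_ne_zero.2 (div_ne_zero he₁ hf₁)) hf₀
    · rw [inner_smul_right, hef₀, mul_zero]
    · rw [hself, hself, norm_smul, Complex.norm_real, norm_div, norm_norm, norm_norm,
        div_mul_cancel₀ _ hf₁]
  have hconj : ∀ r, τ (conj r) = conj (τ r) := by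
    intro r
    -- These two vectors are orthogonal because `e` and `f` are orthogonal of equal norm;
    -- orthogonality of their images is the identity sought.
    have h1 := horth (e + r • f) (-(conj r • e) + f) (by
      simp only [inner_add_left, inner_add_right, inner_neg_right, inner_smul_left,
        inner_smul_right, hef, inner_eq_zero_symm.1 hef, hfe]
      ring)
    simp only [hadd, hneg, hsmul, inner_add_left, inner_add_right, inner_neg_right,
      inner_smul_left, inner_smul_right, horth e f hef, horth f e (inner_eq_zero_symm.1 hef),
      hnorm e f hef hfe] at h1
    have h2 : (conj (τ r) - τ (conj r)) * ⟪U f, U f⟫_ℂ = 0 := by linear_combination h1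
    exact (sub_eq_zero.1 ((mul_eq_zero.1 h2).resolve_right (inner_self_ne_zero.2 (hne f hf)))).symm
  have hreal : ∀ r : ℝ, τ r = r := by
    intro r
    rcases ringHom_eq_id_or_conj hconj with h | h
    · exact h r
    · rw [h, Complex.conj_ofReal]
  -- the common factor by which `U` scales squared norms
  let s : ℝ := ‖U e‖ / ‖e‖
  have hs : 0 < s := div_pos (norm_pos_iff.2 (hne e he)) (norm_pos_iff.2 he)
  have hs2 : ((s : ℂ)) ^ 2 * ⟪e, e⟫_ℂ = ⟪U e, U e⟫_ℂ := by
    rw [hself, hself]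
    norm_cast
    rw [← mul_pow, div_mul_cancel₀ _ (norm_ne_zero_iff.2 he)]
  have hsq : ∀ r, conj (τ r) * τ r = conj r * r := by
    intro r
    rw [← hconj, ← map_mul, mul_comm, Complex.mul_conj, hreal]
  have hUperp : ∀ x : D, ⟪e, x⟫_ℂ = 0 → ⟪U x, U x⟫_ℂ = (s : ℂ) ^ 2 * ⟪x, x⟫_ℂ := by
    intro x hx
    -- Rescaling gives two orthogonal vectors of equal norm.
    have h1 := hnorm (((‖x‖ : ℝ) : ℂ) • e) (((‖e‖ : ℝ) : ℂ) • x)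
      (by simp only [inner_smul_left, inner_smul_right, hx, mul_zero])
      (by
        rw [hself, hself, norm_smul, norm_smul, Complex.norm_real, Complex.norm_real, norm_norm,
          norm_norm, mul_comm])
    simp only [hsmul, hreal, inner_smul_left, inner_smul_right, Complex.conj_ofReal, ← hs2] at h1
    rw [hself e, hself x] at *
    have he₁ : ((‖e‖ : ℝ) : ℂ) ≠ 0 := Complex.ofReal_ne_zero.2 (norm_ne_zero_iff.2 he)
    apply mul_left_cancel₀ (pow_ne_zero 2 he₁)
    push_cast at h1 ⊢
    linear_combination -h1
  have hUself : ∀ x : D, ⟪U x, U x⟫_ℂ = (s : ℂ) ^ 2 * ⟪x, x⟫_ℂ := by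
    intro x
    obtain ⟨r, z, rfl, hz⟩ : ∃ (r : ℂ) (z : D), x = r • e + z ∧ ⟪e, z⟫_ℂ = 0 :=
      ⟨_, _, (add_sub_cancel _ _).symm, inner_sub_proj x e⟩
    simp only [hadd, hsmul, inner_add_left, inner_add_right, inner_smul_left, inner_smul_right,
      hz, inner_eq_zero_symm.1 hz, horth e z hz, horth z e (inner_eq_zero_symm.1 hz), hUperp z hz,
      ← hs2]
    linear_combination (s : ℂ) ^ 2 * ⟪e, e⟫_ℂ * hsq r
  have hUinner : ∀ x y : D, ⟪U x, U y⟫_ℂ = (s : ℂ) ^ 2 * τ ⟪x, y⟫_ℂ := by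
    intro x y
    obtain ⟨r, z, rfl, hz⟩ : ∃ (r : ℂ) (z : D), y = r • x + z ∧ ⟪x, z⟫_ℂ = 0 :=
      ⟨_, _, (add_sub_cancel _ _).symm, inner_sub_proj y x⟩
    rw [hadd, hsmul, inner_add_right, inner_smul_right, horth x z hz, hUself, inner_add_right, hz,
      inner_smul_right, add_zero, add_zero, map_mul, hself x, hreal]
    ring
  have hs0 : (s : ℂ) ≠ 0 := Complex.ofReal_ne_zero.2 hs.ne'
  let V : D → D := fun x => (s : ℂ)⁻¹ • U x
  have hVadd : ∀ x y, V (x + y) = V x + V y := fun x y => by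
    simp only [V, hadd, smul_add]
  have hVsmul : ∀ (r : ℂ) (x), V (r • x) = τ r • V x := fun r x => by
    simp only [V, hsmul, smul_comm (τ r)]
  have hVsurj : Function.Surjective V := fun y => by
    obtain ⟨x, hx⟩ := hsurj ((s : ℂ) • y)
    exact ⟨x, by simp only [V, hx, inv_smul_smul₀ hs0]⟩
  have hVinner : ∀ x y : D, ⟪V x, V y⟫_ℂ = τ ⟪x, y⟫_ℂ := fun x y => by
    simp only [V, inner_smul_left, inner_smul_right, hUinner, map_inv₀, Complex.conj_ofReal]
    field_simp
  refine ⟨s, V, hs, fun x => (smul_inv_smul₀ hs0 _).symm, ?_⟩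
  rcases ringHom_eq_id_or_conj hconj with h | h
  · exact Or.inl ⟨hVadd, fun r x => by rw [hVsmul, h], hVsurj, fun x y => by rw [hVinner, h]⟩
  · exact Or.inr ⟨hVadd, fun r x => by rw [hVsmul, h], hVsurj, fun x y => by
      rw [hVinner, h, inner_conj_symm]⟩

/-! ### Rank one operators and the order `LeftLE`. -/

/-- The rank one operator `z ↦ ⟪y, z⟫ x` of `L⁺(D)`. -/
noncomputable def rankOne (x y : D) : LPlus D :=
  ⟨(innerₛₗ ℂ y).smulRight x, (innerₛₗ ℂ x).smulRight y, fun u v => by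
    simp only [LinearMap.smulRight_apply, innerₛₗ_apply_apply,
      inner_smul_left, inner_smul_right, inner_conj_symm, Submodule.coe_inner]
    ring⟩

theorem rankOne_apply (x y z : D) : (rankOne x y).1 z = ⟪y, z⟫_ℂ • x := rfl

theorem star_rankOne (x y : D) : star (rankOne x y) = rankOne y x :=
  star_unique fun u v => by
    rw [rankOne_apply, rankOne_apply, inner_smul_left, inner_smul_right, inner_conj_symm, mul_comm]

theorem isFiniteRank_rankOne (x y : D) : IsFiniteRank (rankOne x y) := by
  have h : LinearMap.range (rankOne x y).1 ≤ Submodule.span ℂ {x} := by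
    rintro _ ⟨z, rfl⟩
    exact Submodule.mem_span_singleton.2 ⟨_, rfl⟩
  exact Submodule.finiteDimensional_of_le h

variable {𝒜 : StarSubalgebra ℂ (LPlus D)}

/-- The rank one operators as elements of a standard algebra. -/
noncomputable def IsStandard.rk (h𝒜 : IsStandard 𝒜) (x y : D) : 𝒜 :=
  ⟨rankOne x y, h𝒜 _ (isFiniteRank_rankOne x y)⟩

theorem coe_ext {A B : 𝒜} (h : ∀ v : D, A.1.1 v = B.1.1 v) : A = B :=
  Subtype.ext (Subtype.ext (LinearMap.ext h))

theorem star_mul_eq_zero_iff {A B : 𝒜} :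
    star A * B = 0 ↔ ∀ u v : D, ⟪A.1.1 u, B.1.1 v⟫_ℂ = 0 := by
  have key : ∀ u v : D, ⟪u, (star A * B).1.1 v⟫_ℂ = ⟪A.1.1 u, B.1.1 v⟫_ℂ := fun u v => by
    have h := inner_star_left (star A.1) u (B.1.1 v)
    rw [star_star] at h
    exact h.symm
  constructor
  · intro h u v
    rw [← key, h]
    exact inner_zero_right u
  · intro h
    refine coe_ext fun v => ext_inner_left ℂ fun u => ?_
    rw [key, h]
    exact (inner_zero_right u).symm

/-- Everything orthogonal to the range of `B` is orthogonal to the range of `A`. -/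
def LeftLE (A B : 𝒜) : Prop :=
  ∀ C : 𝒜, star C * B = 0 → star C * A = 0

namespace IsStandard

variable (h𝒜 : IsStandard 𝒜)

theorem rk_apply (x y z : D) : (h𝒜.rk x y).1.1 z = ⟪y, z⟫_ℂ • x := rfl

theorem star_rk (x y : D) : star (h𝒜.rk x y) = h𝒜.rk y x :=
  Subtype.ext (star_rankOne x y)

theorem rk_add_left (x y z : D) : h𝒜.rk (x + y) z = h𝒜.rk x z + h𝒜.rk y z :=
  coe_ext fun _ => smul_add _ x y

theorem rk_zero_left (y : D) : h𝒜.rk 0 y = 0 :=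
  coe_ext fun _ => smul_zero _

theorem rk_zero_right (x : D) : h𝒜.rk x 0 = 0 :=
  coe_ext fun v => by rw [rk_apply, inner_zero_left, zero_smul]; rfl

theorem rk_left_injective {y : D} (hy : y ≠ 0) {a b : D} (h : h𝒜.rk a y = h𝒜.rk b y) : a = b := by
  have h1 : (h𝒜.rk a y).1.1 y = (h𝒜.rk b y).1.1 y := by rw [h]
  exact smul_right_injective D (inner_self_ne_zero.2 hy : ⟪y, y⟫_ℂ ≠ 0) h1

theorem rk_right_injective {x : D} (hx : x ≠ 0) {a b : D} (h : h𝒜.rk x a = h𝒜.rk x b) : a = b :=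
  h𝒜.rk_left_injective hx (by rw [← star_rk, h, star_rk])

theorem rk_ne_zero {x y : D} (hx : x ≠ 0) (hy : y ≠ 0) : h𝒜.rk x y ≠ 0 := fun h =>
  hx (h𝒜.rk_left_injective hy (h.trans (h𝒜.rk_zero_left y).symm))

/-- If w is the component of Av orthogonal to x, then w⊗w has range orthogonal to x, hence to the
range of A. So w is orthogonal to both x and Av, and therefore to itself. -/
theorem leftLE_rk_iff {A : 𝒜} {x y : D} (hy : y ≠ 0) :
    LeftLE A (h𝒜.rk x y) ↔ ∃ z, A = h𝒜.rk x z := by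
  constructor
  · intro h
    have hline : ∀ v, A.1.1 v = (⟪x, A.1.1 v⟫_ℂ / ⟪x, x⟫_ℂ) • x := by
      intro v
      have hw := inner_sub_proj (A.1.1 v) x
      set w := A.1.1 v - (⟪x, A.1.1 v⟫_ℂ / ⟪x, x⟫_ℂ) • x with hwdef
      have h1 := star_mul_eq_zero_iff.1 (h (h𝒜.rk w w) (star_mul_eq_zero_iff.2 fun u v => by
        rw [rk_apply, rk_apply, inner_smul_left, inner_smul_right, inner_eq_zero_symm.1 hw,
          mul_zero, mul_zero])) w v
      rw [rk_apply, inner_smul_left] at h1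
      by_contra hne
      have hw0 : w ≠ 0 := sub_ne_zero.2 hne
      have h2 : ⟪w, A.1.1 v⟫_ℂ = 0 :=
        (mul_eq_zero.1 h1).resolve_left ((map_ne_zero _).2 (inner_self_ne_zero.2 hw0))
      have h3 : ⟪w, w⟫_ℂ = 0 := by
        nth_rewrite 2 [hwdef]
        rw [inner_sub_right, inner_smul_right, inner_eq_zero_symm.1 hw, h2, mul_zero, sub_zero]
      exact hw0 (inner_self_eq_zero.1 h3)
    -- The coefficient ⟪x, Av⟫ equals ⟪A⁺x, v⟫, which dictates the right vector.
    refine ⟨conj (⟪x, x⟫_ℂ)⁻¹ • (star A.1).1 x, coe_ext fun v => ?_⟩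
    rw [rk_apply, inner_smul_left, Complex.conj_conj, inner_star_left, hline v, inner_smul_right]
    by_cases hx : x = 0
    · simp [hx]
    · congr 1
      have : ⟪x, x⟫_ℂ ≠ 0 := inner_self_ne_zero.2 hx
      field_simp
  · rintro ⟨z, rfl⟩ C hC
    rw [star_mul_eq_zero_iff] at hC ⊢
    intro u v
    have h1 := hC u y
    rw [rk_apply, inner_smul_right] at h1
    rw [rk_apply, inner_smul_right,
      (mul_eq_zero.1 h1).resolve_left (inner_self_ne_zero.2 hy), mul_zero]

end IsStandard

/-! ### The action of an orthogonality preserver on rank one operators. -/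

/-- An additive bijection that preserves orthogonality of ranges and of coranges in both
directions. -/
structure IsOrthogonalityPreserver (Φ : 𝒜 → 𝒜) : Prop where
  map_add : ∀ A B, Φ (A + B) = Φ A + Φ B
  bijective : Function.Bijective Φ
  left : ∀ A B, star A * B = 0 ↔ star (Φ A) * Φ B = 0
  right : ∀ A B, A * star B = 0 ↔ Φ A * star (Φ B) = 0

namespace IsOrthogonalityPreserver

variable {Φ : 𝒜 → 𝒜} (hΦ : IsOrthogonalityPreserver Φ) (h𝒜 : IsStandard 𝒜)
include hΦ

/-- Conjugating by the involution exchanges the two conditions, so facts about one vector of x⊗y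
transfer to the other. -/
theorem conjStar : IsOrthogonalityPreserver fun A => star (Φ (star A)) where
  map_add A B := by simp only [star_add, hΦ.map_add]
  bijective := star_involutive.bijective.comp (hΦ.bijective.comp star_involutive.bijective)
  left A B := by
    have h := hΦ.right (star A) (star B)
    rw [star_star] at h
    rw [h, star_star]
  right A B := by
    have h := hΦ.left (star A) (star B)
    rw [star_star] at h
    rw [h, star_star]

theorem map_zero : Φ 0 = 0 := (AddMonoidHom.mk' Φ hΦ.map_add).map_zero

theorem map_sub (A B : 𝒜) : Φ (A - B) = Φ A - Φ B :=
  _root_.map_sub (AddMonoidHom.mk' Φ hΦ.map_add) A B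

theorem map_ne_zero {A : 𝒜} (hA : A ≠ 0) : Φ A ≠ 0 := fun h =>
  hA (hΦ.bijective.1 (h.trans hΦ.map_zero.symm))

theorem leftLE_iff {A B : 𝒜} : LeftLE (Φ A) (Φ B) ↔ LeftLE A B := by
  constructor
  · intro h C hC
    exact (hΦ.left _ _).2 (h _ ((hΦ.left _ _).1 hC))
  · intro h C hC
    obtain ⟨C, rfl⟩ := hΦ.bijective.2 C
    exact (hΦ.left _ _).1 (h _ ((hΦ.left _ _).2 hC))

/-- For x' ≠ 0 in the range of Φ(x⊗y), the preimage of x'⊗x' lies below x⊗y, so it is some x⊗z with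
z ≠ 0. Then x⊗y lies below x⊗z as well, which puts Φ(x⊗y) below x'⊗x'. -/
theorem exists_map_rk {x y : D} (hx : x ≠ 0) (hy : y ≠ 0) :
    ∃ x' y', x' ≠ 0 ∧ y' ≠ 0 ∧ Φ (h𝒜.rk x y) = h𝒜.rk x' y' := by
  have hA := hΦ.map_ne_zero (h𝒜.rk_ne_zero hx hy)
  obtain ⟨v, hv⟩ : ∃ v, (Φ (h𝒜.rk x y)).1.1 v ≠ 0 := by
    by_contra! h
    exact hA (coe_ext h)
  set x' := (Φ (h𝒜.rk x y)).1.1 v with hx'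
  obtain ⟨B, hB⟩ := hΦ.bijective.2 (h𝒜.rk x' x')
  have hB0 : B ≠ 0 := by
    rintro rfl
    exact h𝒜.rk_ne_zero hv hv (hB.symm.trans hΦ.map_zero)
  have h1 : LeftLE (Φ B) (Φ (h𝒜.rk x y)) := by
    intro C hC
    rw [star_mul_eq_zero_iff] at hC
    rw [hB, star_mul_eq_zero_iff]
    intro u w
    rw [h𝒜.rk_apply, inner_smul_right, hx', hC, mul_zero]
  rw [hΦ.leftLE_iff, h𝒜.leftLE_rk_iff hy] at h1
  obtain ⟨z, rfl⟩ := h1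
  have hz : z ≠ 0 := by
    rintro rfl
    exact hB0 (h𝒜.rk_zero_right x)
  have h2 : LeftLE (h𝒜.rk x y) (h𝒜.rk x z) := (h𝒜.leftLE_rk_iff hz).2 ⟨y, rfl⟩
  rw [← hΦ.leftLE_iff, hB, h𝒜.leftLE_rk_iff hv] at h2
  obtain ⟨y', hy'⟩ := h2
  refine ⟨x', y', hv, ?_, hy'⟩
  rintro rfl
  exact hA (hy'.trans (h𝒜.rk_zero_right x'))

theorem exists_map_rk_right {x y x' y' : D} (hy : y ≠ 0) (hy' : y' ≠ 0)
    (h : Φ (h𝒜.rk x y) = h𝒜.rk x' y') (z : D) : ∃ z', Φ (h𝒜.rk x z) = h𝒜.rk x' z' := by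
  rw [← h𝒜.leftLE_rk_iff hy', ← h, hΦ.leftLE_iff, h𝒜.leftLE_rk_iff hy]
  exact ⟨z, rfl⟩

theorem exists_rk_map_right {x y x' y' : D} (hy : y ≠ 0) (hy' : y' ≠ 0)
    (h : Φ (h𝒜.rk x y) = h𝒜.rk x' y') (z' : D) : ∃ z, Φ (h𝒜.rk x z) = h𝒜.rk x' z' := by
  obtain ⟨B, hB⟩ := hΦ.bijective.2 (h𝒜.rk x' z')
  have h1 : LeftLE (Φ B) (Φ (h𝒜.rk x y)) := by
    rw [h, hB, h𝒜.leftLE_rk_iff hy']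
    exact ⟨z', rfl⟩
  rw [hΦ.leftLE_iff, h𝒜.leftLE_rk_iff hy] at h1
  obtain ⟨z, rfl⟩ := h1
  exact ⟨z, hB⟩

omit hΦ in
theorem conjStar_map_rk {x y x' y' : D} :
    star (Φ (star (h𝒜.rk y x))) = h𝒜.rk y' x' ↔ Φ (h𝒜.rk x y) = h𝒜.rk x' y' := by
  rw [h𝒜.star_rk, ← h𝒜.star_rk x' y', star_inj]

theorem exists_map_rk_left {x y x' y' : D} (hx : x ≠ 0) (hx' : x' ≠ 0)
    (h : Φ (h𝒜.rk x y) = h𝒜.rk x' y') (z : D) : ∃ z', Φ (h𝒜.rk z y) = h𝒜.rk z' y' := by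
  obtain ⟨z', hz'⟩ := hΦ.conjStar.exists_map_rk_right h𝒜 hx hx' ((conjStar_map_rk h𝒜).2 h) z
  exact ⟨z', (conjStar_map_rk h𝒜).1 hz'⟩

theorem exists_rk_map_left {x y x' y' : D} (hx : x ≠ 0) (hx' : x' ≠ 0)
    (h : Φ (h𝒜.rk x y) = h𝒜.rk x' y') (z' : D) : ∃ z, Φ (h𝒜.rk z y) = h𝒜.rk z' y' := by
  obtain ⟨z, hz⟩ := hΦ.conjStar.exists_rk_map_right h𝒜 hx hx' ((conjStar_map_rk h𝒜).2 h) z'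
  exact ⟨z, (conjStar_map_rk h𝒜).1 hz⟩

/-- The maps of vectors induced by fixing one of the two vectors of a rank one operator. -/
theorem exists_left_map (hdim : Module.finrank ℂ D ≠ 1) [Nontrivial D] {x₀ y₀ x₁ y₁ : D}
    (hx₀ : x₀ ≠ 0) (hy₀ : y₀ ≠ 0) (hx₁ : x₁ ≠ 0) (hy₁ : y₁ ≠ 0)
    (h₀ : Φ (h𝒜.rk x₀ y₀) = h𝒜.rk x₁ y₁) :
    ∃ U : D → D, (∀ x, Φ (h𝒜.rk x y₀) = h𝒜.rk (U x) y₁) ∧ (∀ x y, U (x + y) = U x + U y) ∧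
      (∀ x, x ≠ 0 → U x ≠ 0) ∧ (∀ x y, ⟪x, y⟫_ℂ = 0 → ⟪U x, U y⟫_ℂ = 0) ∧
      ∃ (a : ℝ) (V : D → D), 0 < a ∧ (∀ x, U x = (a : ℂ) • V x) ∧
        (IsUnitaryOn V ∨ IsAntiunitaryOn V) := by
  choose U hU using hΦ.exists_map_rk_left h𝒜 hx₀ hx₁ h₀
  have hadd : ∀ x y, U (x + y) = U x + U y := fun x y => by
    apply h𝒜.rk_left_injective hy₁
    rw [← hU, h𝒜.rk_add_left, hΦ.map_add, hU, hU, h𝒜.rk_add_left]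
  have hne : ∀ x, x ≠ 0 → U x ≠ 0 := fun x hx h => by
    apply hΦ.map_ne_zero (h𝒜.rk_ne_zero hx hy₀)
    rw [hU, h, h𝒜.rk_zero_left]
  have horth : ∀ x y, ⟪x, y⟫_ℂ = 0 → ⟪U x, U y⟫_ℂ = 0 := by
    intro x y hxy
    have h1 := (hΦ.left (h𝒜.rk x y₀) (h𝒜.rk y y₀)).1 (star_mul_eq_zero_iff.2 fun u v => by
      rw [h𝒜.rk_apply, h𝒜.rk_apply, inner_smul_left, inner_smul_right, hxy, mul_zero, mul_zero])
    have h2 := star_mul_eq_zero_iff.1 h1 y₁ y₁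
    have h3 : ⟪y₁, y₁⟫_ℂ ≠ 0 := inner_self_ne_zero.2 hy₁
    rw [hU, hU, h𝒜.rk_apply, h𝒜.rk_apply, inner_smul_left, inner_smul_right] at h2
    exact (mul_eq_zero.1 ((mul_eq_zero.1 h2).resolve_left ((_root_.map_ne_zero _).2 h3))).resolve_left h3
  refine ⟨U, hU, hadd, hne, horth, exists_unitary_or_antiunitary hdim hadd ?_ hne ?_ horth⟩
  · intro y
    obtain ⟨x, hx⟩ := hΦ.exists_rk_map_left h𝒜 hx₀ hx₁ h₀ y
    exact ⟨x, h𝒜.rk_left_injective hy₁ ((hU x).symm.trans hx)⟩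
  · intro r x
    -- Moving the scalar to the right vector keeps the left vector `x`, so the image keeps the left
    -- vector `U x`.
    have h1 : h𝒜.rk (r • x) y₀ = h𝒜.rk x (conj r • y₀) := coe_ext fun v => by
      rw [h𝒜.rk_apply, h𝒜.rk_apply, inner_smul_left, Complex.conj_conj, smul_smul, mul_comm]
    obtain ⟨z, hz⟩ := hΦ.exists_map_rk_right h𝒜 hy₀ hy₁ (hU x) (conj r • y₀)
    rw [← h1, hU] at hz
    have h2 : (h𝒜.rk (U (r • x)) y₁).1.1 y₁ = (h𝒜.rk (U x) z).1.1 y₁ := by rw [hz]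
    rw [h𝒜.rk_apply, h𝒜.rk_apply] at h2
    refine ⟨(⟪y₁, y₁⟫_ℂ)⁻¹ * ⟪z, y₁⟫_ℂ, ?_⟩
    rw [mul_smul, ← h2, inv_smul_smul₀ (inner_self_ne_zero.2 hy₁)]

end IsOrthogonalityPreserver

theorem IsUnitaryOn.exists_inverse {W : D → D} (hW : IsUnitaryOn W) :
    ∃ V : D → D, IsUnitaryOn V ∧ (∀ x, W (V x) = x) ∧ ∀ x, V (W x) = x := by
  have hinj : ∀ {x y}, W x = W y → x = y := fun {x y} h =>
    ext_inner_left ℂ fun v => by rw [← hW.inner_map, h, hW.inner_map]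
  choose V hV using hW.surjective
  exact ⟨V, ⟨fun x y => hinj (by simp only [hW.map_add, hV]),
    fun r x => hinj (by simp only [hW.map_smul, hV]), fun x => ⟨W x, hinj (hV _)⟩,
    fun x y => by rw [← hW.inner_map, hV, hV]⟩, hV, fun x => hinj (hV _)⟩

theorem IsAntiunitaryOn.exists_inverse {W : D → D} (hW : IsAntiunitaryOn W) :
    ∃ V : D → D, IsAntiunitaryOn V ∧ (∀ x, W (V x) = x) ∧ ∀ x, V (W x) = x := by
  have hinj : ∀ {x y}, W x = W y → x = y := fun {x y} h =>
    ext_inner_left ℂ fun v => by rw [← hW.inner_map, h, hW.inner_map]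
  choose V hV using hW.surjective
  exact ⟨V, ⟨fun x y => hinj (by simp only [hW.map_add, hV]),
    fun r x => hinj (by simp only [hW.map_smul, hV, Complex.conj_conj]),
    fun x => ⟨W x, hinj (hV _)⟩,
    fun x y => by rw [← hW.inner_map, hV, hV]⟩, hV, fun x => hinj (hV _)⟩

theorem isUnitaryOn_id : IsUnitaryOn (id : D → D) :=
  ⟨fun _ _ => rfl, fun _ _ => rfl, Function.surjective_id, fun _ _ => rfl⟩

/-! ### From rank one operators to the whole algebra. -/

namespace IsOrthogonalityPreserver

variable {Φ : 𝒜 → 𝒜} (hΦ : IsOrthogonalityPreserver Φ) (h𝒜 : IsStandard 𝒜)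
include hΦ

/-- The values on rank one operators determine `Φ`. -/
theorem apply_eq_of_map_rk {τ : ℂ → ℂ} {a b : ℝ} {U V W : D → D} (ha : 0 < a) (hb : 0 < b)
    (h : ∀ x y, Φ (h𝒜.rk x y) = h𝒜.rk ((a : ℂ) • U x) ((b : ℂ) • W y))
    (hW : ∀ x y, ⟪W x, W y⟫_ℂ = τ ⟪x, y⟫_ℂ) (hWV : ∀ x, W (V x) = x) (hτ : τ 1 = 1)
    (hU : ∀ x, x ≠ 0 → U x ≠ 0) (hU0 : U 0 = 0) [Nontrivial D] (T : 𝒜) (z : D) :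
    (Φ T).1.1 z = ((a * b : ℝ) : ℂ) • U (T.1.1 (V z)) := by
  have ha0 : (a : ℂ) ≠ 0 := Complex.ofReal_ne_zero.2 ha.ne'
  have hb0 : (b : ℂ) ≠ 0 := Complex.ofReal_ne_zero.2 hb.ne'
  set x := V z with hx
  have hz : z = W x := (hWV z).symm
  -- The normalisation gives Rx = Tx; for x = 0 both sides are zero.
  set R : 𝒜 := h𝒜.rk (T.1.1 x) (conj (⟪x, x⟫_ℂ)⁻¹ • x) with hR
  have hRx : x ≠ 0 → ⟪conj (⟪x, x⟫_ℂ)⁻¹ • x, x⟫_ℂ = 1 := fun hx0 => by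
    rw [inner_smul_left, Complex.conj_conj, inv_mul_cancel₀ (inner_self_ne_zero.2 hx0)]
  have hS : (T - R).1.1 x = 0 := by
    have h1 : (T - R).1.1 x = T.1.1 x - R.1.1 x := rfl
    rw [h1, hR, h𝒜.rk_apply]
    by_cases hx0 : x = 0
    · simp [hx0]
    · rw [hRx hx0, one_smul, sub_self]
  obtain ⟨e, he⟩ := exists_ne (0 : D)
  have h1 : (T - R) * star (h𝒜.rk e x) = 0 := by
    rw [h𝒜.star_rk]
    refine coe_ext fun v => ?_
    change (T - R).1.1 ((h𝒜.rk x e).1.1 v) = 0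
    rw [h𝒜.rk_apply, LinearMap.map_smul, hS, smul_zero]
  rw [hΦ.right, h, h𝒜.star_rk] at h1
  have hUe : (a : ℂ) • U e ≠ 0 := smul_ne_zero ha0 (hU e he)
  have h2 : (Φ (T - R)).1.1 ((h𝒜.rk ((b : ℂ) • W x) ((a : ℂ) • U e)).1.1 ((a : ℂ) • U e)) = 0 :=
    congrArg (fun A : 𝒜 => A.1.1 ((a : ℂ) • U e)) h1
  rw [h𝒜.rk_apply, LinearMap.map_smul, LinearMap.map_smul, ← hz,
    smul_eq_zero_iff_right (inner_self_ne_zero.2 hUe), smul_eq_zero_iff_right hb0,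
    hΦ.map_sub] at h2
  have h3 : (Φ T).1.1 z = (Φ R).1.1 z := sub_eq_zero.1 h2
  rw [h3, hR, h, h𝒜.rk_apply, inner_smul_left, Complex.conj_ofReal, hz, hW]
  by_cases hx0 : x = 0
  · rw [hx0, LinearMap.map_zero, hU0, smul_zero, smul_zero, smul_zero, smul_zero]
  · rw [hRx hx0, hτ, smul_smul]
    congr 1
    push_cast
    ring

include h𝒜 in
theorem exists_unitary_or_antiunitary_pair (hdim : Module.finrank ℂ D ≠ 1) [Nontrivial D] :
    ∃ (c : ℝ) (U V : D → D), 0 < c ∧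
      ((IsUnitaryOn U ∧ IsUnitaryOn V) ∨ (IsAntiunitaryOn U ∧ IsAntiunitaryOn V)) ∧
      ∀ (T : 𝒜) (x : D), (Φ T).1.1 x = (c : ℂ) • U (T.1.1 (V x)) := by
  obtain ⟨e, he⟩ := exists_ne (0 : D)
  obtain ⟨x₁, y₁, hx₁, hy₁, h₀⟩ := hΦ.exists_map_rk h𝒜 he he
  obtain ⟨U, hU, hUadd, hUne, hUorth, a, U', ha, hUU', hU'⟩ :=
    hΦ.exists_left_map h𝒜 hdim he he hx₁ hy₁ h₀
  obtain ⟨W, hW, hWadd, hWne, -, b, W', hb, hWW', hW'⟩ :=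
    hΦ.conjStar.exists_left_map h𝒜 hdim he he hy₁ hx₁ ((conjStar_map_rk h𝒜).2 h₀)
  replace hW := fun y => (conjStar_map_rk h𝒜).1 (hW y)
  have hW0 : W 0 = 0 := (AddMonoidHom.mk' W hWadd).map_zero
  have hU0 : U 0 = 0 := (AddMonoidHom.mk' U hUadd).map_zero
  have hUe : U e = x₁ := h𝒜.rk_left_injective hy₁ ((hU e).symm.trans h₀)
  have hrk : ∀ x y, Φ (h𝒜.rk x y) = h𝒜.rk (U x) (W y) := by
    intro x y
    by_cases hy : y = 0
    · rw [hy, hW0, h𝒜.rk_zero_right, h𝒜.rk_zero_right, hΦ.map_zero]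
    have hWy := hWne y hy
    choose f hf using hΦ.exists_map_rk_left h𝒜 he hx₁ (hW y)
    -- For fixed `y` the left vector of the image is pointwise, hence globally, a multiple of `U`;
    -- the value at `e` shows that the factor is 1.
    obtain ⟨k, hk⟩ := exists_smul_of_forall_exists_smul (f := f) (g := U)
      (fun u v => h𝒜.rk_left_injective hWy (by
        rw [← hf, h𝒜.rk_add_left, hΦ.map_add, hf, hf, h𝒜.rk_add_left]))
      hUadd
      (fun u => by
        obtain ⟨v, hv⟩ := hΦ.exists_map_rk_right h𝒜 he hy₁ (hU u) y
        have h2 : (h𝒜.rk (f u) (W y)).1.1 (W y) = (h𝒜.rk (U u) v).1.1 (W y) := by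
          rw [← hf, ← hv]
        rw [h𝒜.rk_apply, h𝒜.rk_apply] at h2
        refine ⟨(⟪W y, W y⟫_ℂ)⁻¹ * ⟪v, W y⟫_ℂ, ?_⟩
        rw [mul_smul, ← h2, inv_smul_smul₀ (inner_self_ne_zero.2 hWy)])
      (exists_independent_image hdim hUne hUorth)
    have hfe : f e = x₁ := h𝒜.rk_left_injective hWy ((hf e).symm.trans (hW y))
    have hk1 : k = 1 := smul_left_injective ℂ hx₁ (by
      have h2 := hk e
      rw [hfe, hUe] at h2
      simpa using h2.symm)
    rw [hf, hk, hk1, one_smul]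
  -- The identity (ie)⊗e = e⊗(-ie) links the two semilinearities and excludes a mixed pair.
  have hsame : ∀ u w : ℂ, U' (Complex.I • e) = u • U' e → W' (conj Complex.I • e) = w • W' e →
      u = conj w := by
    intro u w hu hw
    have h1 : h𝒜.rk (Complex.I • e) e = h𝒜.rk e (conj Complex.I • e) := coe_ext fun v => by
      rw [h𝒜.rk_apply, h𝒜.rk_apply, inner_smul_left, Complex.conj_conj, smul_smul, mul_comm]
    have h2 : Φ (h𝒜.rk (Complex.I • e) e) = Φ (h𝒜.rk e (conj Complex.I • e)) := by rw [h1]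
    rw [hrk, hrk, hUU' (Complex.I • e), hWW' (conj Complex.I • e), hu, hw, smul_comm _ u,
      smul_comm _ w, ← hUU', ← hWW'] at h2
    have h3 : (h𝒜.rk (u • U e) (W e)).1.1 (W e) = (h𝒜.rk (U e) (w • W e)).1.1 (W e) := by rw [h2]
    rw [h𝒜.rk_apply, h𝒜.rk_apply, inner_smul_left, smul_smul] at h3
    have h4 := smul_left_injective ℂ (hUne e he) h3
    rw [mul_comm] at h4
    exact mul_right_cancel₀ (inner_self_ne_zero.2 (hWne e he)) h4
  have hI : Complex.I ≠ -Complex.I := fun h => by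
    have := congrArg Complex.im h
    norm_num at this
  have hU'ne : ∀ x, x ≠ 0 → U' x ≠ 0 := fun x hx h => hUne x hx (by rw [hUU', h, smul_zero])
  have hU'0 : U' 0 = 0 := by
    have h1 := hUU' 0
    rw [hU0] at h1
    exact (smul_eq_zero.1 h1.symm).resolve_left (Complex.ofReal_ne_zero.2 ha.ne')
  have hrk' : ∀ x y, Φ (h𝒜.rk x y) = h𝒜.rk ((a : ℂ) • U' x) ((b : ℂ) • W' y) := fun x y => by
    rw [hrk, hUU', hWW']
  rcases hU' with hU' | hU' <;> rcases hW' with hW' | hW'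
  · obtain ⟨V, hV, hWV, -⟩ := hW'.exists_inverse
    exact ⟨a * b, U', V, mul_pos ha hb, Or.inl ⟨hU', hV⟩,
      hΦ.apply_eq_of_map_rk h𝒜 ha hb hrk' (τ := id) hW'.inner_map hWV rfl hU'ne hU'0⟩
  · have h1 := hsame _ _ (hU'.map_smul _ _) (hW'.map_smul _ _)
    rw [Complex.conj_conj, Complex.conj_I] at h1
    exact absurd h1 hI
  · have h1 := hsame _ _ (hU'.map_smul _ _) (hW'.map_smul _ _)
    rw [Complex.conj_conj, Complex.conj_I] at h1
    exact absurd h1.symm hI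
  · obtain ⟨V, hV, hWV, -⟩ := hW'.exists_inverse
    exact ⟨a * b, U', V, mul_pos ha hb, Or.inr ⟨hU', hV⟩,
      hΦ.apply_eq_of_map_rk h𝒜 ha hb hrk' (τ := conj)
        (fun x y => by rw [hW'.inner_map, inner_conj_symm]) hWV (_root_.map_one _) hU'ne hU'0⟩

end IsOrthogonalityPreserver

end UnboundedOp

/-! ### The theorem. -/

theorem corollary3p2 {H : Type*} [NormedAddCommGroup H] [InnerProductSpace ℂ H] [CompleteSpace H]
    (D : Submodule ℂ H) (hD : UnboundedOp.IsFDomain D) (hdim : Module.finrank ℂ D ≠ 1)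
    (𝒜 : StarSubalgebra ℂ (UnboundedOp.LPlus D)) (h𝒜 : UnboundedOp.IsStandard 𝒜)
    (Φ : 𝒜 → 𝒜) (hadd : ∀ A B : 𝒜, Φ (A + B) = Φ A + Φ B) (hbij : Function.Bijective Φ)
    (hleft : ∀ A B : 𝒜, star A * B = 0 ↔ star (Φ A) * Φ B = 0)
    (hright : ∀ A B : 𝒜, A * star B = 0 ↔ Φ A * star (Φ B) = 0) :
    (∃ (c : ℂ) (U V : D → D), c ≠ 0 ∧
      ((UnboundedOp.IsUnitaryOn U ∧ UnboundedOp.IsUnitaryOn V) ∨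
        (UnboundedOp.IsAntiunitaryOn U ∧ UnboundedOp.IsAntiunitaryOn V)) ∧
      ∀ (T : 𝒜) (x : D), (Φ T).1.1 x = c • U (T.1.1 (V x))) ∧
    (Φ 1 = 1 →
      ∃ U Uadj : D → D,
        ((UnboundedOp.IsUnitaryOn U ∧ UnboundedOp.IsAdjointOn U Uadj) ∨
          (UnboundedOp.IsAntiunitaryOn U ∧ UnboundedOp.IsAntiAdjointOn U Uadj)) ∧
        ∀ (T : 𝒜) (x : D), (Φ T).1.1 x = U (T.1.1 (Uadj x))) := by
  have hΦ : UnboundedOp.IsOrthogonalityPreserver Φ := ⟨hadd, hbij, hleft, hright⟩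
  -- `Module.finrank` is 0 for infinite-dimensional spaces too, so `hdim` excludes only dimension
  -- one; the zero space is treated apart.
  rcases subsingleton_or_nontrivial D with hD0 | hD0
  · exact ⟨⟨1, id, id, one_ne_zero,
      Or.inl ⟨UnboundedOp.isUnitaryOn_id, UnboundedOp.isUnitaryOn_id⟩,
      fun T x => Subsingleton.elim _ _⟩, fun _ => ⟨id, id,
      Or.inl ⟨UnboundedOp.isUnitaryOn_id, fun _ _ => rfl⟩, fun T x => Subsingleton.elim _ _⟩⟩
  obtain ⟨c, U, V, hc, hUV, h⟩ := hΦ.exists_unitary_or_antiunitary_pair h𝒜 hdim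
  refine ⟨⟨c, U, V, Complex.ofReal_ne_zero.2 hc.ne', hUV, h⟩, fun h1 => ?_⟩
  have hone : ∀ x, (c : ℂ) • U (V x) = x := fun x => by
    have h2 := h 1 x
    rw [h1] at h2
    exact h2.symm
  obtain ⟨e, he⟩ := exists_ne (0 : D)
  have hnorm : ⟪U (V e), U (V e)⟫_ℂ = ⟪e, e⟫_ℂ := by
    rcases hUV with ⟨hU, hV⟩ | ⟨hU, hV⟩ <;> rw [hU.inner_map, hV.inner_map]
  -- Since UV is isometric and c UV = I, the positive number c is 1, and V is the inverse of U, that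
  -- is U⁺.
  have hc2 : (c : ℂ) * c = 1 := by
    have h2 : ⟪(c : ℂ) • U (V e), (c : ℂ) • U (V e)⟫_ℂ = ⟪e, e⟫_ℂ := by rw [hone]
    rw [inner_smul_left, inner_smul_right, hnorm, Complex.conj_ofReal, ← mul_assoc] at h2
    exact mul_right_cancel₀ (inner_self_ne_zero.2 he) (h2.trans (one_mul _).symm)
  have hc1 : c = 1 := by
    have h2 : c * c = 1 := by exact_mod_cast hc2
    nlinarith
  have hUVx : ∀ x, U (V x) = x := fun x => by
    have h2 := hone x
    rwa [hc1, Complex.ofReal_one, one_smul] at h2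
  refine ⟨U, V, ?_, fun T x => by rw [h, hc1, Complex.ofReal_one, one_smul]⟩
  rcases hUV with ⟨hU, hV⟩ | ⟨hU, hV⟩
  · exact Or.inl ⟨hU, fun x y => by rw [← hU.inner_map, hUVx]⟩
  · exact Or.inr ⟨hU, fun x y => by rw [← hU.inner_map, hUVx]⟩
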